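/- Let $n\ge 1$ and let $0<k_1\le k_2\le\dots\le k_n$ be real numbers with $2m:=\sum_{i=1}^n k_i>1$. The configuration graph $C_{\mathbf k}$ is the weighted graph on the nodes $1,\dots,n$, without self-loops, in which any two distinct nodes $i,j$ are joined by a link of weight $c_{ij}=k_ik_j/(2m-1)$. Let $Q$ be its Laplacian ($Q_{ii}=\sum_{j\ne i}c_{ij}$ and $Q_{ij}=-c_{ij}$ for $i\neq j$), let $Q^\dagger$ be the Moore–Penrose pseudoinverse of $Q$, let $\omega_{ij}=(e_i-e_j)^TQ^\dagger(e_i-e_j)$ be the effective resistance, and $\Omega=(\omega_{ij})$. A maximum variance distribution is a maximizer $\mathbf p^\star$ of $\tfrac12\mathbf p^T\Omega\mathbf p$ over the probability simplex $\Delta_n=\{\mathbf p\in\mathbb R^n: p_i\ge 0,\ \sum_i p_i=1\}$. Then: 1. For all $i\ne j$, $\ \omega_{ij}=\frac{2m-1}{2m}\left(k_i^{-1}+k_j^{-1}\right)$. 2. There is exactly one maximum variance distribution $\mathbf p^\star$. Let $\mathcal V^\star_{\mathbf k}=\{i: p^\star_i>0\}$ be its support (the maximum variance support). 3. If $n\ge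 3$, there is exactly one $\ell\in\{3,\dots,n\}$ with $$k_\ell<\frac{1}{\ell-2}\sum_{i=1}^{\ell}k_i\le k_{\ell+1}\qquad(k_{n+1}:=\infty),$$ and for this $\ell$ the support $\mathcal V^\star_{\mathbf k}$ is the set $\{1,\dots,\ell\}$ of the $\ell$ nodes of smallest degree. 4. If $n\ge 3$, there is also exactly one $\ell\in\{3,\dots,n\}$ with $$k_\ell\le\frac{1}{\ell-2}\sum_{i=1}^{\ell}k_i< k_{\ell+1}\qquad(k_{n+1}:=\infty),$$ and for this $\ell$ the support $\mathcal V^\star_{\mathbf k}$ is the set of those nodes $i\le\ell$ with $k_i<\frac{1}{\ell-2}\sum_{j=1}^{\ell}k_j$; in particular it is $\{1,\dots,\ell\}$ unless $k_\ell=\frac{1}{\ell-2}\sum_{i=1}^{\ell}k_i$. 5. If $n\le 2$, then $\mathcal V^\star_{\mathbf k}=\{1,\dots,n\}$. -/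

import Mathlib

/-- `B` is a Moore–Penrose pseudoinverse of the real matrix `A`: the four Penrose conditions. -/
structure IsMoorePenroseInverse {ι : Type*} [Fintype ι] (A B : Matrix ι ι ℝ) : Prop where
  mul_mul_self : A * B * A = A
  self_mul_mul : B * A * B = B
  isSymm_mul : (A * B).IsSymm
  isSymm_mul' : (B * A).IsSymm

/-- A pseudoinverse of a real symmetric matrix, by diagonalization. -/
theorem exists_isMoorePenroseInverse_of_isHermitian {ι : Type*} [Fintype ι] [DecidableEq ι]
    (A : Matrix ι ι ℝ) (hA : A.IsHermitian) :
    ∃ B : Matrix ι ι ℝ, B.IsSymm ∧ IsMoorePenroseInverse A B := by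
  obtain ⟨U, d, hU, hAU⟩ : ∃ (U : Matrix ι ι ℝ) (d : ι → ℝ),
      U.transpose * U = 1 ∧ A = U * Matrix.diagonal d * U.transpose := by
    refine ⟨hA.eigenvectorUnitary, hA.eigenvalues, ?_, ?_⟩
    · have h := Unitary.coe_star_mul_self hA.eigenvectorUnitary
      simpa [Matrix.star_eq_conjTranspose, Matrix.conjTranspose_eq_transpose_of_trivial] using h
    · have h := hA.spectral_theorem
      rw [Unitary.conjStarAlgAut_apply] at h
      simpa [Matrix.star_eq_conjTranspose, Matrix.conjTranspose_eq_transpose_of_trivial,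
        Function.comp_def] using h
  have key : ∀ a b : ι → ℝ, U * Matrix.diagonal a * U.transpose *
      (U * Matrix.diagonal b * U.transpose) =
        U * Matrix.diagonal (fun i => a i * b i) * U.transpose := by
    intro a b
    calc _ = U * Matrix.diagonal a * (U.transpose * U) * Matrix.diagonal b * U.transpose := by
          simp only [Matrix.mul_assoc]
      _ = _ := by
          rw [hU, Matrix.mul_one, Matrix.mul_assoc U, Matrix.diagonal_mul_diagonal]
  have symm : ∀ a : ι → ℝ, (U * Matrix.diagonal a * U.transpose).IsSymm := by
    intro a
    simp [Matrix.IsSymm, Matrix.transpose_mul, Matrix.mul_assoc]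
  refine ⟨U * Matrix.diagonal (fun i => (d i)⁻¹) * U.transpose, symm _, ?_, ?_, ?_, ?_⟩
  · rw [hAU, key, key]
    simp
  · rw [hAU, key, key]
    congr 3
    ext i
    by_cases h : d i = 0 <;> simp [h]
  · rw [hAU, key]; exact symm _
  · rw [hAU, key]; exact symm _

theorem exists_isMoorePenroseInverse {ι : Type*} [Fintype ι] (A : Matrix ι ι ℝ) :
    ∃ B : Matrix ι ι ℝ, IsMoorePenroseInverse A B := by
  classical
  have hH : (A.transpose * A).IsHermitian := by
    simp [Matrix.IsHermitian, Matrix.conjTranspose_eq_transpose_of_trivial]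
  obtain ⟨G, hG, h1, h2, h3, h4⟩ := exists_isMoorePenroseInverse_of_isHermitian _ hH
  have hGA : A * (G * (A.transpose * A)) = A := by
    have h0 : (A * (G * (A.transpose * A) - 1)).conjTranspose *
        (A * (G * (A.transpose * A) - 1)) = 0 := by
      rw [Matrix.conjTranspose_eq_transpose_of_trivial, Matrix.transpose_mul]
      have e : A.transpose * (A * (G * (A.transpose * A) - 1)) = 0 := by
        rw [← Matrix.mul_assoc, Matrix.mul_sub, ← Matrix.mul_assoc, h1, Matrix.mul_one, sub_self]
      rw [Matrix.mul_assoc, e, Matrix.mul_zero]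
    rw [Matrix.conjTranspose_mul_self_eq_zero, Matrix.mul_sub, Matrix.mul_one, sub_eq_zero] at h0
    exact h0
  refine ⟨G * A.transpose, ?_, ?_, ?_, ?_⟩
  · simpa [Matrix.mul_assoc] using hGA
  · calc G * A.transpose * A * (G * A.transpose)
        = G * (A.transpose * A) * G * A.transpose := by simp only [Matrix.mul_assoc]
      _ = G * A.transpose := by rw [h2]
  · simp [Matrix.IsSymm, Matrix.transpose_mul, Matrix.mul_assoc, hG.eq]
  · simpa [Matrix.mul_assoc] using h4

theorem IsMoorePenroseInverse.eq {ι : Type*} [Fintype ι] {A B C : Matrix ι ι ℝ}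
    (hB : IsMoorePenroseInverse A B) (hC : IsMoorePenroseInverse A C) : B = C := by
  have h1 : A * B = A * C := by
    calc A * B = (A * C) * (A * B) := by rw [← Matrix.mul_assoc, hC.mul_mul_self]
      _ = (A * C).transpose * (A * B).transpose := by rw [hC.isSymm_mul.eq, hB.isSymm_mul.eq]
      _ = (A * B * A * C).transpose := by rw [← Matrix.transpose_mul]; simp only [Matrix.mul_assoc]
      _ = A * C := by rw [hB.mul_mul_self, hC.isSymm_mul.eq]
  have h2 : B * A = C * A := by
    calc B * A = (B * A) * (C * A) := by
          rw [Matrix.mul_assoc, ← Matrix.mul_assoc A, hC.mul_mul_self]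
      _ = (B * A).transpose * (C * A).transpose := by rw [hC.isSymm_mul'.eq, hB.isSymm_mul'.eq]
      _ = (C * (A * B * A)).transpose := by
          rw [← Matrix.transpose_mul]; simp only [Matrix.mul_assoc]
      _ = C * A := by rw [hB.mul_mul_self, hC.isSymm_mul'.eq]
  calc B = B * A * B := hB.self_mul_mul.symm
    _ = C * A * C := by rw [Matrix.mul_assoc, h1, ← Matrix.mul_assoc, h2]
    _ = C := hC.self_mul_mul

/-- The Moore–Penrose pseudoinverse `A†` of a real square matrix. -/
noncomputable def moorePenrose {ι : Type*} [Fintype ι] (A : Matrix ι ι ℝ) : Matrix ι ι ℝ :=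
  Classical.choose (exists_isMoorePenroseInverse A)

theorem moorePenrose_spec {ι : Type*} [Fintype ι] (A : Matrix ι ι ℝ) :
    IsMoorePenroseInverse A (moorePenrose A) :=
  Classical.choose_spec (exists_isMoorePenroseInverse A)

/-- The Laplacian of the weighted graph with (symmetric, zero-diagonal) matrix of link weights `c`:
the weighted degrees `∑ j, c i j` on the diagonal and `-c i j` off the diagonal. -/
noncomputable def weightedLaplacian {ι : Type*} [Fintype ι] [DecidableEq ι] (c : Matrix ι ι ℝ) :
    Matrix ι ι ℝ :=
  Matrix.diagonal (fun i => ∑ j, c i j) - c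

/-- The effective resistance `ω i j = (e i - e j)ᵀ Q† (e i - e j)`, where `Q` is the Laplacian. -/
noncomputable def effectiveResistance {ι : Type*} [Fintype ι] [DecidableEq ι] (c : Matrix ι ι ℝ)
    (i j : ι) : ℝ :=
  (Pi.single i 1 - Pi.single j 1 : ι → ℝ) ⬝ᵥ
    (moorePenrose (weightedLaplacian c)).mulVec (Pi.single i 1 - Pi.single j 1)

/-- The variance `(1/2) pᵀ Ω p` of a distribution `p` on the nodes, with respect to the square root
of the effective resistance. -/
noncomputable def graphVariance {ι : Type*} [Fintype ι] [DecidableEq ι] (c : Matrix ι ι ℝ)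
    (p : ι → ℝ) : ℝ :=
  (1 / 2) * (p ⬝ᵥ (Matrix.of (effectiveResistance c)).mulVec p)

/-- `p` solves the maximum variance problem: it maximizes the variance over the probability
simplex. -/
def IsMaxVarianceDistribution {ι : Type*} [Fintype ι] [DecidableEq ι] (c : Matrix ι ι ℝ)
    (p : ι → ℝ) : Prop :=
  p ∈ stdSimplex ℝ ι ∧ ∀ q ∈ stdSimplex ℝ ι, graphVariance c q ≤ graphVariance c p

/-- The link weights of the configuration graph with degree sequence `k`: between distinct nodes
`i` and `j` the weight is `k i * k j / (2m - 1)`, where `2m = ∑ r, k r`; there are no self-loops. -/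
noncomputable def configurationWeights {ι : Type*} [Fintype ι] [DecidableEq ι] (k : ι → ℝ) :
    Matrix ι ι ℝ :=
  Matrix.of fun i j => if i = j then 0 else k i * k j / ((∑ r, k r) - 1)

/-- `(ℓ - 2)⁻¹ ∑_{i=1}^ℓ k_i`. The index `i : Fin n` stands for the node numbered `i + 1`. -/
noncomputable def degreeThreshold {n : ℕ} (k : Fin n → ℝ) (ℓ : ℕ) : ℝ :=
  ((ℓ : ℝ) - 2)⁻¹ * ∑ i ∈ Finset.univ.filter (fun i : Fin n => (i : ℕ) < ℓ), k i

/-- `3 ≤ ℓ ≤ n` and `k_ℓ < (ℓ - 2)⁻¹ ∑_{i=1}^ℓ k_i ≤ k_{ℓ+1}`, where `k_{n+1} = ∞`. -/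
def SupportCriterion {n : ℕ} (k : Fin n → ℝ) (ℓ : ℕ) : Prop :=
  3 ≤ ℓ ∧ ℓ ≤ n ∧ (∀ i : Fin n, (i : ℕ) + 1 = ℓ → k i < degreeThreshold k ℓ) ∧
    ∀ i : Fin n, (i : ℕ) = ℓ → degreeThreshold k ℓ ≤ k i

/-- `3 ≤ ℓ ≤ n` and `k_ℓ ≤ (ℓ - 2)⁻¹ ∑_{i=1}^ℓ k_i < k_{ℓ+1}`, where `k_{n+1} = ∞`. -/
def SupportCriterion' {n : ℕ} (k : Fin n → ℝ) (ℓ : ℕ) : Prop :=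
  3 ≤ ℓ ∧ ℓ ≤ n ∧ (∀ i : Fin n, (i : ℕ) + 1 = ℓ → k i ≤ degreeThreshold k ℓ) ∧
    ∀ i : Fin n, (i : ℕ) = ℓ → degreeThreshold k ℓ < k i

/-!
The Laplacian of the configuration graph is a rank-one perturbation of a diagonal matrix, and its
effective resistance is that of a star whose `i`-th leg has resistance `(2m - 1) / (2m) / k i`.
Hence the variance is, up to a positive factor, the separable strictly concave function
`∑ i, (k i)⁻¹ * (p i * (1 - p i))`, whose maximizer over the simplex is determined by the KKT
conditions: `p i = max 0 (1 - t * k i) / 2` for the multiplier `t` that normalizes `p`. With at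
least three nodes `t` is positive and the support is `{i | k i < t⁻¹}`; summing `p` over the first
`ℓ` nodes shows that `t⁻¹` equals `degreeThreshold k ℓ` whenever `t⁻¹` separates the first `ℓ`
degrees from the others.
-/

open Finset Matrix

section EffectiveResistance

variable {ι : Type*} [Fintype ι]

theorem dotProduct_mulVec_of_mul_mul_self {R : Type*} [CommSemiring R] {A G : Matrix ι ι R}
    (hA : A.IsSymm) (hG : A * G * A = A) {x y : ι → R} (hxy : A *ᵥ y = x) :
    x ⬝ᵥ G *ᵥ x = x ⬝ᵥ y := by
  have hyA : y ᵥ* A = x := by rw [← mulVec_transpose, hA.eq, hxy]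
  calc x ⬝ᵥ G *ᵥ x = y ᵥ* A ⬝ᵥ G *ᵥ (A *ᵥ y) := by rw [hyA, hxy]
    _ = y ᵥ* (A * G * A) ⬝ᵥ y := by
      simp only [← dotProduct_mulVec, mulVec_mulVec, Matrix.mul_assoc]
    _ = x ⬝ᵥ y := by rw [hG, hyA]

/-- The matrix is the resistance matrix of the leaves of a star with leg resistances `w`. -/
theorem dotProduct_mulVec_star [DecidableEq ι] {R : Type*} [CommRing R] (w p : ι → R) :
    p ⬝ᵥ (of fun i j => if i = j then 0 else w i + w j) *ᵥ p =
      2 * ∑ i, w i * (p i * (∑ j, p j - p i)) := by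
  have hrow (i : ι) : ((of fun i j => if i = j then 0 else w i + w j) *ᵥ p) i =
      w i * ∑ j, p j + ∑ j, w j * p j - 2 * (w i * p i) := by
    have hentry (j : ι) : (if i = j then 0 else w i + w j) * p j =
        w i * p j + w j * p j - if i = j then 2 * (w i * p i) else 0 := by
      split_ifs with hij
      · subst hij; ring
      · ring
    simp only [mulVec, dotProduct, of_apply, hentry, sum_sub_distrib, sum_add_distrib, mul_sum,
      sum_ite_eq, mem_univ, if_true]
  calc p ⬝ᵥ (of fun i j => if i = j then 0 else w i + w j) *ᵥ p
      = ∑ i, ((∑ j, p j) * (w i * p i) + (∑ j, w j * p j) * p i - 2 * (w i * p i ^ 2)) := by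
        rw [dotProduct]
        exact sum_congr rfl fun i _ => by rw [hrow]; ring
    _ = 2 * ((∑ j, p j) * ∑ i, w i * p i - ∑ i, w i * p i ^ 2) := by
        rw [sum_sub_distrib, sum_add_distrib, ← mul_sum, ← mul_sum, ← mul_sum]
        ring
    _ = 2 * ∑ i, w i * (p i * (∑ j, p j - p i)) := by
        rw [mul_sum, ← sum_sub_distrib]
        exact congrArg _ (sum_congr rfl fun i _ => by ring)

variable [DecidableEq ι]

theorem effectiveResistance_self (c : Matrix ι ι ℝ) (i : ι) : effectiveResistance c i i = 0 := by
  simp [effectiveResistance]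

theorem weightedLaplacian_configurationWeights (k : ι → ℝ) :
    weightedLaplacian (configurationWeights k) =
      (∑ r, k r - 1)⁻¹ • ((∑ r, k r) • diagonal k - vecMulVec k k) := by
  have hentry (i j : ι) : configurationWeights k i j =
      (∑ r, k r - 1)⁻¹ * (k i * k j - if i = j then k i * k i else 0) := by
    rw [configurationWeights, of_apply]
    split_ifs with hij
    · subst hij; ring
    · ring
  have hdegree (i : ι) : ∑ j, configurationWeights k i j =
      (∑ r, k r - 1)⁻¹ * (k i * ∑ r, k r - k i * k i) := by
    simp only [hentry, ← mul_sum, sum_sub_distrib, sum_ite_eq, mem_univ, if_true]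
  ext i j
  simp only [weightedLaplacian, Matrix.sub_apply, Matrix.smul_apply, smul_eq_mul, diagonal_apply,
    vecMulVec_apply, hentry i j, hdegree]
  split_ifs with hij
  · subst hij; ring
  · ring

theorem isSymm_weightedLaplacian_configurationWeights (k : ι → ℝ) :
    (weightedLaplacian (configurationWeights k)).IsSymm := by
  simp only [weightedLaplacian_configurationWeights, IsSymm, transpose_smul, transpose_sub,
    diagonal_transpose, transpose_vecMulVec]

theorem effectiveResistance_configurationWeights {k : ι → ℝ} (hS₀ : ∑ r, k r ≠ 0)
    (hS₁ : ∑ r, k r ≠ 1) {i j : ι} (hi : k i ≠ 0) (hj : k j ≠ 0) (hij : i ≠ j) :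
    effectiveResistance (configurationWeights k) i j =
      (∑ r, k r - 1) / (∑ r, k r) * ((k i)⁻¹ + (k j)⁻¹) := by
  have hS₁' : ∑ r, k r - 1 ≠ 0 := sub_ne_zero.2 hS₁
  set x : ι → ℝ := Pi.single i 1 - Pi.single j 1 with hx
  set z : ι → ℝ := Pi.single i (k i)⁻¹ - Pi.single j (k j)⁻¹ with hz
  have horth : k ⬝ᵥ z = 0 := by simp [hz, dotProduct_sub, hi, hj]
  have hdiag : diagonal k *ᵥ z = x := by
    rw [hz, mulVec_sub, diagonal_mulVec_single, diagonal_mulVec_single, mul_inv_cancel₀ hi,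
      mul_inv_cancel₀ hj]
  have hscale : (∑ r, k r - 1) / (∑ r, k r) * (∑ r, k r - 1)⁻¹ * (∑ r, k r) = 1 := by
    field_simp
  have hsolve : weightedLaplacian (configurationWeights k) *ᵥ
      (((∑ r, k r - 1) / ∑ r, k r) • z) = x := by
    rw [weightedLaplacian_configurationWeights, mulVec_smul, smul_mulVec, sub_mulVec,
      smul_mulVec, vecMulVec_mulVec, horth, hdiag, MulOpposite.op_zero, zero_smul, sub_zero,
      smul_smul, smul_smul, hscale, one_smul]
  calc effectiveResistance (configurationWeights k) i j
      = x ⬝ᵥ (((∑ r, k r - 1) / ∑ r, k r) • z) :=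
        dotProduct_mulVec_of_mul_mul_self (isSymm_weightedLaplacian_configurationWeights k)
          (moorePenrose_spec _).mul_mul_self hsolve
    _ = (∑ r, k r - 1) / (∑ r, k r) * ((k i)⁻¹ + (k j)⁻¹) := by
      simp [hx, hz, hij, hij.symm]

theorem graphVariance_configurationWeights {k : ι → ℝ} (hS₀ : ∑ r, k r ≠ 0)
    (hS₁ : ∑ r, k r ≠ 1) (hk : ∀ i, k i ≠ 0) (p : ι → ℝ) :
    graphVariance (configurationWeights k) p =
      (∑ r, k r - 1) / (∑ r, k r) * ∑ i, (k i)⁻¹ * (p i * (∑ j, p j - p i)) := by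
  have hstar : of (effectiveResistance (configurationWeights k)) =
      ((∑ r, k r - 1) / ∑ r, k r) • of fun i j => if i = j then 0 else (k i)⁻¹ + (k j)⁻¹ := by
    ext i j
    rcases eq_or_ne i j with rfl | hij
    · simp [effectiveResistance_self]
    · simp [effectiveResistance_configurationWeights hS₀ hS₁ (hk i) (hk j) hij, hij]
  rw [graphVariance, hstar, smul_mulVec, dotProduct_smul, smul_eq_mul,
    dotProduct_mulVec_star fun i => (k i)⁻¹]
  ring

end EffectiveResistance

section ThresholdDistribution

variable {ι : Type*} {k : ι → ℝ} {t : ℝ}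

/-- The maximizer over `p ≥ 0` of the Lagrangian `∑ i, (k i)⁻¹ * (p i * (1 - p i)) - t * ∑ i, p i`
of the maximum variance problem. The multiplier `t` is a free parameter: the entries sum to one
only for the right `t`. -/
noncomputable def thresholdDistribution (k : ι → ℝ) (t : ℝ) (i : ι) : ℝ :=
  max 0 (1 - t * k i) / 2

theorem thresholdDistribution_nonneg (k : ι → ℝ) (t : ℝ) (i : ι) :
    0 ≤ thresholdDistribution k t i :=
  div_nonneg (le_max_left _ _) zero_le_two

theorem thresholdDistribution_pos_iff {i : ι} : 0 < thresholdDistribution k t i ↔ t * k i < 1 := by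
  simp [thresholdDistribution]

theorem ofPred_thresholdDistribution_pos (ht₀ : 0 < t) :
    {i | 0 < thresholdDistribution k t i} = {i | k i < t⁻¹} := by
  ext i
  rw [Set.mem_ofPred_eq, thresholdDistribution_pos_iff, ← lt_inv_mul_iff₀ ht₀, mul_one,
    Set.mem_ofPred_eq]

theorem thresholdDistribution_of_mul_le_one {i : ι} (h : t * k i ≤ 1) :
    thresholdDistribution k t i = (1 - t * k i) / 2 := by
  rw [thresholdDistribution, max_eq_right (sub_nonneg.2 h)]

theorem thresholdDistribution_of_one_le_mul {i : ι} (h : 1 ≤ t * k i) :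
    thresholdDistribution k t i = 0 := by
  rw [thresholdDistribution, max_eq_left (sub_nonpos.2 h), zero_div]

/-- The slope `1 - 2 * p` of `x ↦ x * (1 - x)` at `p = thresholdDistribution k t i` is at most
`t * k i`, with equality if `0 < p`: these are the KKT conditions. -/
theorem mul_one_sub_add_sq_le_thresholdDistribution {i : ι} {x : ℝ} (hx : 0 ≤ x) :
    x * (1 - x) + (x - thresholdDistribution k t i) ^ 2 ≤
      thresholdDistribution k t i * (1 - thresholdDistribution k t i) +
        t * k i * (x - thresholdDistribution k t i) := by
  rcases le_total (t * k i) 1 with h | h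
  · rw [thresholdDistribution_of_mul_le_one h]
    exact le_of_eq (by ring)
  · rw [thresholdDistribution_of_one_le_mul h]
    linarith [mul_le_mul_of_nonneg_right h hx]

variable [Fintype ι]

theorem thresholdDistribution_mem_stdSimplex (ht : ∑ i, thresholdDistribution k t i = 1) :
    thresholdDistribution k t ∈ stdSimplex ℝ ι :=
  ⟨thresholdDistribution_nonneg k t, ht⟩

theorem sum_inv_mul_add_sq_le_thresholdDistribution (hk : ∀ i, 0 < k i)
    (ht : ∑ i, thresholdDistribution k t i = 1) {q : ι → ℝ} (hq : q ∈ stdSimplex ℝ ι) :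
    ∑ i, (k i)⁻¹ * (q i * (1 - q i)) + ∑ i, (k i)⁻¹ * (q i - thresholdDistribution k t i) ^ 2 ≤
      ∑ i, (k i)⁻¹ * (thresholdDistribution k t i * (1 - thresholdDistribution k t i)) := by
  have hmultiplier : ∑ i, t * (q i - thresholdDistribution k t i) = 0 := by
    rw [← mul_sum, sum_sub_distrib, hq.2, ht, sub_self, mul_zero]
  rw [← sum_add_distrib, ← add_zero (∑ i, _ * (thresholdDistribution k t i * _)), ← hmultiplier,
    ← sum_add_distrib]
  refine sum_le_sum fun i _ => ?_
  calc (k i)⁻¹ * (q i * (1 - q i)) + (k i)⁻¹ * (q i - thresholdDistribution k t i) ^ 2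
      = (k i)⁻¹ * (q i * (1 - q i) + (q i - thresholdDistribution k t i) ^ 2) := by ring
    _ ≤ (k i)⁻¹ * (thresholdDistribution k t i * (1 - thresholdDistribution k t i) +
          t * k i * (q i - thresholdDistribution k t i)) :=
      mul_le_mul_of_nonneg_left (mul_one_sub_add_sq_le_thresholdDistribution (hq.1 i))
        (inv_nonneg.2 (hk i).le)
    _ = (k i)⁻¹ * (thresholdDistribution k t i * (1 - thresholdDistribution k t i)) +
          t * (q i - thresholdDistribution k t i) := by
      have := (hk i).ne'
      field_simp

theorem isMaxVarianceDistribution_configurationWeights_iff [DecidableEq ι] (hk : ∀ i, 0 < k i)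
    (hS : 1 < ∑ i, k i) (ht : ∑ i, thresholdDistribution k t i = 1) {q : ι → ℝ} :
    IsMaxVarianceDistribution (configurationWeights k) q ↔ q = thresholdDistribution k t := by
  have hmem := thresholdDistribution_mem_stdSimplex ht
  have hfactor : 0 < (∑ r, k r - 1) / ∑ r, k r := div_pos (by linarith) (by linarith)
  have hvariance {p : ι → ℝ} (hp : p ∈ stdSimplex ℝ ι) :
      graphVariance (configurationWeights k) p =
        (∑ r, k r - 1) / (∑ r, k r) * ∑ i, (k i)⁻¹ * (p i * (1 - p i)) := by
    rw [graphVariance_configurationWeights (by linarith) hS.ne' (fun i => (hk i).ne'), hp.2]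
  have hsq_nonneg (q : ι → ℝ) (i : ι) : 0 ≤ (k i)⁻¹ * (q i - thresholdDistribution k t i) ^ 2 :=
    mul_nonneg (inv_nonneg.2 (hk i).le) (sq_nonneg _)
  constructor
  · rintro ⟨hq, hmax⟩
    have hle := hmax _ hmem
    rw [hvariance hmem, hvariance hq, mul_le_mul_iff_right₀ hfactor] at hle
    have hgap := sum_inv_mul_add_sq_le_thresholdDistribution hk ht hq
    have hzero : ∑ i, (k i)⁻¹ * (q i - thresholdDistribution k t i) ^ 2 = 0 :=
      le_antisymm (by linarith) (sum_nonneg fun i _ => hsq_nonneg q i)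
    rw [sum_eq_zero_iff_of_nonneg fun i _ => hsq_nonneg q i] at hzero
    ext i
    simpa [(hk i).ne', sub_eq_zero] using hzero i (mem_univ i)
  · rintro rfl
    refine ⟨hmem, fun q hq => ?_⟩
    rw [hvariance hmem, hvariance hq, mul_le_mul_iff_right₀ hfactor]
    exact (le_add_of_nonneg_right (sum_nonneg fun i _ => hsq_nonneg q i)).trans
      (sum_inv_mul_add_sq_le_thresholdDistribution hk ht hq)

theorem exists_sum_thresholdDistribution_eq_one [Nonempty ι] (hk : ∀ i, 0 < k i) :
    ∃ t, ∑ i, thresholdDistribution k t i = 1 := by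
  obtain ⟨i₀, hmin⟩ := Finite.exists_min k
  have hcont : Continuous fun t => ∑ i, thresholdDistribution k t i := by
    unfold thresholdDistribution
    fun_prop
  have hle_one : ∑ i, thresholdDistribution k (k i₀)⁻¹ i ≤ 1 := by
    rw [sum_eq_zero fun i _ => thresholdDistribution_of_one_le_mul
      ((one_le_inv_mul₀ (hk i₀)).2 (hmin i))]
    exact zero_le_one
  have hone_le : 1 ≤ ∑ i, thresholdDistribution k (-(k i₀)⁻¹) i := by
    have hi₀ : thresholdDistribution k (-(k i₀)⁻¹) i₀ = 1 := by
      norm_num [thresholdDistribution, (hk i₀).ne']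
    exact hi₀.ge.trans
      (single_le_sum (fun i _ => thresholdDistribution_nonneg k _ i) (mem_univ i₀))
  exact mem_range_of_exists_le_of_exists_ge hcont ⟨_, hle_one⟩ ⟨_, hone_le⟩

theorem strictAntiOn_sum_thresholdDistribution (hk : ∀ i, 0 < k i) :
    StrictAntiOn (fun t => ∑ i, thresholdDistribution k t i)
      {t | 0 < ∑ i, thresholdDistribution k t i} := by
  intro t ht u _ htu
  have hmul (i : ι) : t * k i < u * k i := mul_lt_mul_of_pos_right htu (hk i)
  obtain ⟨i₀, -, hi₀⟩ : ∃ i ∈ univ, 0 < thresholdDistribution k t i :=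
    exists_lt_of_sum_lt (by simpa using ht)
  rw [thresholdDistribution_pos_iff] at hi₀
  refine sum_lt_sum (fun i _ => ?_) ⟨i₀, mem_univ i₀, ?_⟩
  · exact div_le_div_of_nonneg_right (max_le_max_left 0 (by linarith [hmul i])) zero_le_two
  · rw [thresholdDistribution_of_mul_le_one hi₀.le, thresholdDistribution]
    exact div_lt_div_of_pos_right (max_lt (by linarith) (by linarith [hmul i₀])) two_pos

theorem pos_iff_two_lt_card_of_sum_thresholdDistribution_eq_one (hk : ∀ i, 0 < k i)
    (ht : ∑ i, thresholdDistribution k t i = 1) : 0 < t ↔ 2 < Fintype.card ι := by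
  have hhalf : ∑ _i : ι, (1 / 2 : ℝ) = Fintype.card ι / 2 := by
    rw [sum_const, card_univ, nsmul_eq_mul, mul_one_div]
  rw [← Nat.cast_lt (α := ℝ), Nat.cast_two]
  constructor
  · intro ht₀
    have hne : (univ : Finset ι).Nonempty := nonempty_of_sum_ne_zero (ht ▸ one_ne_zero)
    have hlt : ∑ i, thresholdDistribution k t i < ∑ _i : ι, (1 / 2 : ℝ) :=
      sum_lt_sum_of_nonempty hne fun i _ => div_lt_div_of_pos_right
        (max_lt one_pos (sub_lt_self 1 (mul_pos ht₀ (hk i)))) two_pos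
    linarith
  · contrapose!
    intro ht₀
    have hle : ∑ _i : ι, (1 / 2 : ℝ) ≤ ∑ i, thresholdDistribution k t i :=
      sum_le_sum fun i _ => div_le_div_of_nonneg_right
        (le_max_of_le_right (by linarith [mul_nonpos_of_nonpos_of_nonneg ht₀ (hk i).le]))
        zero_le_two
    linarith

theorem sum_thresholdDistribution_of_separating {s : Finset ι} (hs : ∀ i ∈ s, t * k i ≤ 1)
    (hsc : ∀ i ∉ s, 1 ≤ t * k i) :
    ∑ i, thresholdDistribution k t i = (#s - t * ∑ i ∈ s, k i) / 2 := by
  rw [← sum_subset (subset_univ s) fun i _ hi => thresholdDistribution_of_one_le_mul (hsc i hi),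
    sum_congr rfl fun i hi => thresholdDistribution_of_mul_le_one (hs i hi), ← sum_div,
    sum_sub_distrib, ← mul_sum, sum_const, nsmul_one]

end ThresholdDistribution

section InitialSegment

variable {n ℓ : ℕ} {s : Set (Fin n)}

theorem eq_ofPred_val_lt_iff (hs : IsLowerSet s) (h₀ : 0 < ℓ) (hℓ : ℓ ≤ n) :
    s = {i : Fin n | (i : ℕ) < ℓ} ↔
      (∀ i : Fin n, (i : ℕ) + 1 = ℓ → i ∈ s) ∧ ∀ i : Fin n, (i : ℕ) = ℓ → i ∉ s := by
  constructor
  · rintro rfl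
    simp only [Set.mem_ofPred_eq]
    exact ⟨fun i hi => by omega, fun i hi => by omega⟩
  · rintro ⟨hlast, hnext⟩
    ext i
    refine ⟨fun hi => ?_, fun hi => ?_⟩
    · by_contra hnot
      have hle : ℓ ≤ (i : ℕ) := not_lt.1 hnot
      exact hnext ⟨ℓ, hle.trans_lt i.2⟩ rfl (hs (Fin.le_def.2 hle) hi)
    · exact hs (Fin.le_def.2 (Nat.le_sub_one_of_lt hi))
        (hlast ⟨ℓ - 1, by omega⟩ (Nat.sub_add_cancel h₀))

theorem existsUnique_eq_ofPred_val_lt (hs : IsLowerSet s) :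
    ∃! ℓ, ℓ ≤ n ∧ s = {i : Fin n | (i : ℕ) < ℓ} := by
  refine existsUnique_of_exists_of_unique ?_ fun ℓ ℓ' hℓ hℓ' => ?_
  · rcases hs.eq_univ_or_Iio with rfl | ⟨a, rfl⟩
    · exact ⟨n, le_rfl, (Set.eq_univ_of_forall Fin.is_lt).symm⟩
    · exact ⟨a, a.2.le, rfl⟩
  · have hcard := congrArg Set.ncard (hℓ.2.symm.trans hℓ'.2)
    simpa [Set.ncard_eq_toFinset_card', Fin.card_filter_val_lt, hℓ.1, hℓ'.1] using hcard

end InitialSegment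

section SupportCriterion

variable {n ℓ : ℕ} {k : Fin n → ℝ} {t : ℝ}

theorem supportCriterion_iff_ofPred_lt_degreeThreshold (hmono : Monotone k) :
    SupportCriterion k ℓ ↔
      3 ≤ ℓ ∧ ℓ ≤ n ∧ {i | k i < degreeThreshold k ℓ} = {i : Fin n | (i : ℕ) < ℓ} := by
  refine and_congr_right fun h₃ => and_congr_right fun hℓ => ?_
  have hlower : IsLowerSet {i | k i < degreeThreshold k ℓ} := fun _ _ hij => (hmono hij).trans_lt
  simp only [eq_ofPred_val_lt_iff hlower (by omega) hℓ, Set.mem_ofPred_eq, not_lt]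

theorem supportCriterion'_iff_ofPred_le_degreeThreshold (hmono : Monotone k) :
    SupportCriterion' k ℓ ↔
      3 ≤ ℓ ∧ ℓ ≤ n ∧ {i | k i ≤ degreeThreshold k ℓ} = {i : Fin n | (i : ℕ) < ℓ} := by
  refine and_congr_right fun h₃ => and_congr_right fun hℓ => ?_
  have hlower : IsLowerSet {i | k i ≤ degreeThreshold k ℓ} := fun _ _ hij => (hmono hij).trans
  simp only [eq_ofPred_val_lt_iff hlower (by omega) hℓ, Set.mem_ofPred_eq, not_le]

/-- `T` separates the first `ℓ` values of `k` from the remaining ones. Equality with `T` is allowed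
on both sides, so that both support criteria are instances. -/
def SeparatesAt (k : Fin n → ℝ) (ℓ : ℕ) (T : ℝ) : Prop :=
  (∀ i : Fin n, (i : ℕ) < ℓ → k i ≤ T) ∧ ∀ i : Fin n, ℓ ≤ (i : ℕ) → T ≤ k i

theorem separatesAt_of_ofPred_lt_eq {T : ℝ} (h : {i | k i < T} = {i : Fin n | (i : ℕ) < ℓ}) :
    SeparatesAt k ℓ T :=
  have hiff (i : Fin n) : k i < T ↔ (i : ℕ) < ℓ := Set.ext_iff.1 h i
  ⟨fun i hi => ((hiff i).2 hi).le, fun i hi => not_lt.1 (mt (hiff i).1 hi.not_gt)⟩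

theorem separatesAt_of_ofPred_le_eq {T : ℝ} (h : {i | k i ≤ T} = {i : Fin n | (i : ℕ) < ℓ}) :
    SeparatesAt k ℓ T :=
  have hiff (i : Fin n) : k i ≤ T ↔ (i : ℕ) < ℓ := Set.ext_iff.1 h i
  ⟨fun i hi => (hiff i).2 hi, fun i hi => (not_le.1 (mt (hiff i).1 hi.not_gt)).le⟩

theorem SeparatesAt.sum_thresholdDistribution (ht₀ : 0 < t) (hℓ : ℓ ≤ n)
    (h : SeparatesAt k ℓ t⁻¹) :
    ∑ i, thresholdDistribution k t i = (ℓ - t * ∑ i ∈ {i : Fin n | (i : ℕ) < ℓ}, k i) / 2 := by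
  rw [sum_thresholdDistribution_of_separating (s := {i : Fin n | (i : ℕ) < ℓ}),
    Fin.card_filter_val_lt, min_eq_right hℓ]
  · intro i hi
    exact (le_inv_mul_iff₀ ht₀).1 (by simpa using h.1 i (by simpa using hi))
  · intro i hi
    exact (inv_le_iff_one_le_mul₀' ht₀).1 (h.2 i (by simpa using hi))

theorem sum_filter_val_lt_pos (hk : ∀ i, 0 < k i) (h₀ : 0 < ℓ) (hℓ : ℓ ≤ n) :
    0 < ∑ i ∈ {i : Fin n | (i : ℕ) < ℓ}, k i :=
  sum_pos (fun i _ => hk i) ⟨⟨0, h₀.trans_le hℓ⟩, by simpa using h₀⟩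

theorem degreeThreshold_pos (hk : ∀ i, 0 < k i) (h₃ : 3 ≤ ℓ) (hℓ : ℓ ≤ n) :
    0 < degreeThreshold k ℓ := by
  have h₃' : (3 : ℝ) ≤ ℓ := by exact_mod_cast h₃
  exact mul_pos (inv_pos.2 (by linarith)) (sum_filter_val_lt_pos hk (by omega) hℓ)

theorem SeparatesAt.sum_thresholdDistribution_eq_one_iff (hk : ∀ i, 0 < k i) (ht₀ : 0 < t)
    (hℓ : ℓ ≤ n) (h : SeparatesAt k ℓ t⁻¹) :
    ∑ i, thresholdDistribution k t i = 1 ↔ 3 ≤ ℓ ∧ degreeThreshold k ℓ = t⁻¹ := by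
  rw [h.sum_thresholdDistribution ht₀ hℓ, degreeThreshold]
  constructor
  · intro hsum
    have h₀ : 0 < ℓ := by
      rw [Nat.pos_iff_ne_zero]
      rintro rfl
      simp at hsum
    have hpos := mul_pos ht₀ (sum_filter_val_lt_pos hk h₀ hℓ)
    have hlt : (2 : ℝ) < ℓ := by linarith
    refine ⟨by exact_mod_cast hlt, ?_⟩
    rw [show (ℓ : ℝ) - 2 = t * ∑ i ∈ {i : Fin n | (i : ℕ) < ℓ}, k i by linarith, mul_inv,
      inv_mul_cancel_right₀ (sum_filter_val_lt_pos hk h₀ hℓ).ne']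
  · rintro ⟨h₃, hT⟩
    have h₃' : (3 : ℝ) ≤ ℓ := by exact_mod_cast h₃
    rw [inv_mul_eq_iff_eq_mul₀ (by linarith), ← div_eq_mul_inv, eq_div_iff ht₀.ne'] at hT
    linarith

theorem SeparatesAt.degreeThreshold_eq_inv (hk : ∀ i, 0 < k i)
    (ht : ∑ i, thresholdDistribution k t i = 1) (h₃ : 3 ≤ ℓ) (hℓ : ℓ ≤ n)
    (h : SeparatesAt k ℓ (degreeThreshold k ℓ)) : degreeThreshold k ℓ = t⁻¹ := by
  rw [← inv_inv (degreeThreshold k ℓ)] at h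
  have hone : ∑ i, thresholdDistribution k (degreeThreshold k ℓ)⁻¹ i = 1 :=
    (h.sum_thresholdDistribution_eq_one_iff hk (inv_pos.2 (degreeThreshold_pos hk h₃ hℓ)) hℓ).2
      ⟨h₃, (inv_inv _).symm⟩
  exact inv_eq_iff_eq_inv.1 ((strictAntiOn_sum_thresholdDistribution hk).injOn
    (by simp [hone]) (by simp [ht]) (hone.trans ht.symm))

theorem SupportCriterion.degreeThreshold_eq_inv (h : SupportCriterion k ℓ) (hk : ∀ i, 0 < k i)
    (hmono : Monotone k) (ht : ∑ i, thresholdDistribution k t i = 1) :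
    degreeThreshold k ℓ = t⁻¹ :=
  have ⟨h₃, hℓ, heq⟩ := (supportCriterion_iff_ofPred_lt_degreeThreshold hmono).1 h
  (separatesAt_of_ofPred_lt_eq heq).degreeThreshold_eq_inv hk ht h₃ hℓ

theorem SupportCriterion'.degreeThreshold_eq_inv (h : SupportCriterion' k ℓ) (hk : ∀ i, 0 < k i)
    (hmono : Monotone k) (ht : ∑ i, thresholdDistribution k t i = 1) :
    degreeThreshold k ℓ = t⁻¹ :=
  have ⟨h₃, hℓ, heq⟩ := (supportCriterion'_iff_ofPred_le_degreeThreshold hmono).1 h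
  (separatesAt_of_ofPred_le_eq heq).degreeThreshold_eq_inv hk ht h₃ hℓ

theorem supportCriterion_iff_ofPred_lt_inv (hk : ∀ i, 0 < k i) (hmono : Monotone k) (ht₀ : 0 < t)
    (ht : ∑ i, thresholdDistribution k t i = 1) :
    SupportCriterion k ℓ ↔ ℓ ≤ n ∧ {i | k i < t⁻¹} = {i : Fin n | (i : ℕ) < ℓ} := by
  refine ⟨fun h => ?_, fun ⟨hℓ, heq⟩ => ?_⟩
  · rw [← h.degreeThreshold_eq_inv hk hmono ht]
    exact ((supportCriterion_iff_ofPred_lt_degreeThreshold hmono).1 h).2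
  · obtain ⟨h₃, hT⟩ := ((separatesAt_of_ofPred_lt_eq heq).sum_thresholdDistribution_eq_one_iff
      hk ht₀ hℓ).1 ht
    exact (supportCriterion_iff_ofPred_lt_degreeThreshold hmono).2 ⟨h₃, hℓ, hT.symm ▸ heq⟩

theorem supportCriterion'_iff_ofPred_le_inv (hk : ∀ i, 0 < k i) (hmono : Monotone k) (ht₀ : 0 < t)
    (ht : ∑ i, thresholdDistribution k t i = 1) :
    SupportCriterion' k ℓ ↔ ℓ ≤ n ∧ {i | k i ≤ t⁻¹} = {i : Fin n | (i : ℕ) < ℓ} := by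
  refine ⟨fun h => ?_, fun ⟨hℓ, heq⟩ => ?_⟩
  · rw [← h.degreeThreshold_eq_inv hk hmono ht]
    exact ((supportCriterion'_iff_ofPred_le_degreeThreshold hmono).1 h).2
  · obtain ⟨h₃, hT⟩ := ((separatesAt_of_ofPred_le_eq heq).sum_thresholdDistribution_eq_one_iff
      hk ht₀ hℓ).1 ht
    exact (supportCriterion'_iff_ofPred_le_degreeThreshold hmono).2 ⟨h₃, hℓ, hT.symm ▸ heq⟩

theorem exists_pos_sum_thresholdDistribution_eq_one (hk : ∀ i, 0 < k i) (hn : 3 ≤ n) :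
    ∃ t > 0, ∑ i, thresholdDistribution k t i = 1 := by
  have : NeZero n := ⟨by omega⟩
  obtain ⟨t, ht⟩ := exists_sum_thresholdDistribution_eq_one hk
  refine ⟨t, (pos_iff_two_lt_card_of_sum_thresholdDistribution_eq_one hk ht).2 ?_, ht⟩
  rwa [Fintype.card_fin]

theorem existsUnique_supportCriterion (hk : ∀ i, 0 < k i) (hmono : Monotone k) (hn : 3 ≤ n) :
    ∃! ℓ, SupportCriterion k ℓ := by
  obtain ⟨t, ht₀, ht⟩ := exists_pos_sum_thresholdDistribution_eq_one hk hn
  simp only [supportCriterion_iff_ofPred_lt_inv hk hmono ht₀ ht]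
  exact existsUnique_eq_ofPred_val_lt fun _ _ hij => (hmono hij).trans_lt

theorem existsUnique_supportCriterion' (hk : ∀ i, 0 < k i) (hmono : Monotone k) (hn : 3 ≤ n) :
    ∃! ℓ, SupportCriterion' k ℓ := by
  obtain ⟨t, ht₀, ht⟩ := exists_pos_sum_thresholdDistribution_eq_one hk hn
  simp only [supportCriterion'_iff_ofPred_le_inv hk hmono ht₀ ht]
  exact existsUnique_eq_ofPred_val_lt fun _ _ hij => (hmono hij).trans

end SupportCriterion

theorem mainTheorem5 (n : ℕ) (k : Fin n → ℝ) (hpos : ∀ i, 0 < k i) (hmono : Monotone k)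
    (hm : 1 < ∑ i, k i) :
    (∀ i j : Fin n, i ≠ j → effectiveResistance (configurationWeights k) i j =
      ((∑ r, k r) - 1) / (∑ r, k r) * ((k i)⁻¹ + (k j)⁻¹)) ∧
    ∃ p : Fin n → ℝ,
      IsMaxVarianceDistribution (configurationWeights k) p ∧
      (∀ q, IsMaxVarianceDistribution (configurationWeights k) q → q = p) ∧
      (3 ≤ n →
        (∃! ℓ : ℕ, SupportCriterion k ℓ) ∧
        (∀ ℓ : ℕ, SupportCriterion k ℓ → {i | 0 < p i} = {i : Fin n | (i : ℕ) < ℓ}) ∧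
        (∃! ℓ : ℕ, SupportCriterion' k ℓ) ∧
        (∀ ℓ : ℕ, SupportCriterion' k ℓ →
          {i | 0 < p i} = {i : Fin n | (i : ℕ) < ℓ ∧ k i < degreeThreshold k ℓ})) ∧
      (n ≤ 2 → {i | 0 < p i} = Set.univ) := by
  refine ⟨fun i j hij => effectiveResistance_configurationWeights (by linarith) hm.ne'
    (hpos i).ne' (hpos j).ne' hij, ?_⟩
  have : Nonempty (Fin n) :=
    univ_nonempty_iff.1 (nonempty_of_sum_ne_zero (one_pos.trans hm).ne')
  obtain ⟨t, ht⟩ := exists_sum_thresholdDistribution_eq_one hpos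
  have ht_pos : 0 < t ↔ 2 < n := by
    simpa using pos_iff_two_lt_card_of_sum_thresholdDistribution_eq_one hpos ht
  have hmax (q) := isMaxVarianceDistribution_configurationWeights_iff hpos hm ht (q := q)
  refine ⟨thresholdDistribution k t, (hmax _).2 rfl, fun q => (hmax q).1,
    fun hn => ?_, fun hn => ?_⟩
  · have ht₀ := ht_pos.2 hn
    rw [ofPred_thresholdDistribution_pos ht₀]
    refine ⟨existsUnique_supportCriterion hpos hmono hn,
      fun ℓ hℓ => ((supportCriterion_iff_ofPred_lt_inv hpos hmono ht₀ ht).1 hℓ).2,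
      existsUnique_supportCriterion' hpos hmono hn, fun ℓ hℓ => ?_⟩
    have hle := ((supportCriterion'_iff_ofPred_le_inv hpos hmono ht₀ ht).1 hℓ).2
    rw [hℓ.degreeThreshold_eq_inv hpos hmono ht, Set.ofPred_and, ← hle]
    exact (Set.inter_eq_right.2 (Set.ofPred_subset_ofPred.2 fun _ => le_of_lt)).symm
  · have ht₀ : t ≤ 0 := not_lt.1 (mt ht_pos.1 (by omega))
    exact Set.eq_univ_of_forall fun i => thresholdDistribution_pos_iff.2
      ((mul_nonpos_of_nonpos_of_nonneg ht₀ (hpos i).le).trans_lt one_pos)
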